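/- Let $A,B$ be $n\times n$ matrices over a semiring that are $d$-sparse (at most $d$ nonzero entries in each row and each column), where $1\le d\le n$, and let $S\subseteq[n]\times[n]$ be a set of positions, at most $d$ in each row and each column, at which the product $C=AB$ is wanted. A *term* is a triple $(i,j,k)$ with $A_{ij}\ne 0$, $B_{jk}\ne 0$ and $(i,k)\in S$; it stands for the product $A_{ij}B_{jk}$. An *iteration* consists of $\lfloor n/d\rfloor$ clusters $(I_a,J_a,K_a)$, where $I_a,J_a,K_a\subseteq[n]$ have exactly $d$ elements each, the sets $I_a$ are pairwise disjoint, and so are the sets $J_a$ and the sets $K_a$. It multiplies, for each $a$, the $d\times d$ submatrices $A[I_a,J_a]$ and $B[J_a,K_a]$, and so computes those uncomputed terms $(i,j,k)$ that lie in $I_a\times J_a\times K_a$ for some $a$. Let $0\le\varepsilon_1<\varepsilon_2$. Any set $T$ of uncomputed terms with $|T|=O(d^{2-\varepsilon_1}n)$ can be reduced to a set $T'$ of uncomputed terms with $|T'|=O(d^{2-\varepsilon_2}n)$ by $l=O(d^{4\varepsilon_2})$ sequential iterations. Precisely: for all $0\le\varepsilon_1<\varepsilon_2$ and all $C_1,C_2>0$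 there is a constant $K>0$ such that for every semiring, all $1\le d\le n$, all $A,B,S$ as above and every set $T$ of terms with $|T|\le C_1d^{2-\varepsilon_1}n$, there is a sequence of at most $K d^{4\varepsilon_2}$ iterations after which at most $C_2d^{2-\varepsilon_2}n$ of the terms of $T$ remain uncomputed. -/

import Mathlib

namespace SparseMM

/-- A set of positions of an `n × n` matrix with at most `d` positions in each row and
in each column. -/
def SparsePattern {n : ℕ} (d : ℕ) (P : Fin n → Fin n → Prop) : Prop :=
  (∀ i, {j | P i j}.ncard ≤ d) ∧ (∀ j, {i | P i j}.ncard ≤ d)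

/-- A matrix is `d`-sparse if each row and each column has at most `d` nonzero entries. -/
def IsSparse {n : ℕ} {R : Type*} [Semiring R] (d : ℕ) (A : Matrix (Fin n) (Fin n) R) : Prop :=
  SparsePattern d (fun i j => A i j ≠ 0)

/-- The triple `(i, j, k)` stands for the term `A i j * B j k` of the entry `(i, k)` of `A * B`. -/
abbrev Term (n : ℕ) : Type := Fin n × Fin n × Fin n

open Classical in
/-- The terms of the product `A * B` that are needed for the entries at the positions in `S`:
those with both factors nonzero. -/
noncomputable def terms {n : ℕ} {R : Type*} [Semiring R] (A B : Matrix (Fin n) (Fin n) R)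
    (S : Finset (Fin n × Fin n)) : Finset (Term n) :=
  Finset.univ.filter fun t => A t.1 t.2.1 ≠ 0 ∧ B t.2.1 t.2.2 ≠ 0 ∧ (t.1, t.2.2) ∈ S

/-- One iteration of clustered square multiplication: `⌊n / d⌋` disjoint clusters, the `a`-th
of which multiplies the `d × d` submatrix of `A` with rows `rows a` and columns `mids a` by the
`d × d` submatrix of `B` with rows `mids a` and columns `cols a`. -/
structure Iteration (n d : ℕ) where
  rows : Fin (n / d) → Finset (Fin n)
  mids : Fin (n / d) → Finset (Fin n)
  cols : Fin (n / d) → Finset (Fin n)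
  card_rows : ∀ a, (rows a).card = d
  card_mids : ∀ a, (mids a).card = d
  card_cols : ∀ a, (cols a).card = d
  disjoint_rows : ∀ a b, a ≠ b → Disjoint (rows a) (rows b)
  disjoint_mids : ∀ a b, a ≠ b → Disjoint (mids a) (mids b)
  disjoint_cols : ∀ a b, a ≠ b → Disjoint (cols a) (cols b)

/-- The iteration computes exactly the terms that lie inside one of its clusters. -/
def Iteration.Computes {n d : ℕ} (L : Iteration n d) (t : Term n) : Prop :=
  ∃ a, t.1 ∈ L.rows a ∧ t.2.1 ∈ L.mids a ∧ t.2.2 ∈ L.cols a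

open Classical in
/-- The terms of `T` that are still uncomputed after one iteration. -/
noncomputable def Iteration.uncomputed {n d : ℕ} (L : Iteration n d) (T : Finset (Term n)) :
    Finset (Term n) :=
  T.filter fun t => ¬ L.Computes t

/-- The terms of `T` that are still uncomputed after a sequence of iterations. -/
noncomputable def uncomputedAfter {n d : ℕ} :
    List (Iteration n d) → Finset (Term n) → Finset (Term n)
  | [], T => T
  | L :: Ls, T => uncomputedAfter Ls (L.uncomputed T)

end SparseMM

namespace SparseMM

/-! Terms form a tripartite 3-uniform hypergraph on three copies of `[n]`, in which sparsity bounds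
by `d` the neighbours of a vertex in each other part. It suffices that any set of at least `θ d² n`
triples, `θ ≤ 1`, has an iteration computing `θ⁴ d² n / 18432` of them (`exists_iteration`): with
`θ` of order `d ^ (-ε₂)`, `O(θ⁻⁴)` repetitions would use up the `O(d² n)` triples available.

One cluster: suppose that every occurring pair of coordinates lies in at least `τ` triples, `τ` of
order `θ d`, and let `x` be a vertex of maximum degree `Δ`. The two neighbourhoods of `x` have at
most `d` vertices each and span at least `Δ τ` triples; some `d` vertices of the part of `x` retain
`(Δ τ)² / (4 d³)` of these (`exists_heavy_fibers`, `exists_dense_cluster`). The codegree condition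
comes from a subset maximising the number of triples minus `τ` per occurring pair
(`exists_subset_le_card_fiber`).

Packing: discarding all triples that meet a cluster costs at most `3 d Δ`. The same `Δ` governs gain
and cost, so the cost is `O(θ⁻³)` times the gain. Hence greedy selection either fills all `⌊n / d⌋`
clusters or exhausts the potential, and both outcomes compute enough (`exists_packing`). -/

/-- On each fibre of `f` in `T`, the map `g` takes at most `d` values. -/
def FiberBound {α V W : Type*} [DecidableEq V] [DecidableEq W] (d : ℕ) (T : Finset α)
    (f : α → V) (g : α → W) : Prop :=
  ∀ v, ((T.filter fun t => f t = v).image g).card ≤ d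

/-! ### Projections, fibres and a single dense cluster -/

section Projections

variable {α V W X : Type*} [DecidableEq V] [DecidableEq W] [DecidableEq X]

theorem FiberBound.mono {d : ℕ} {T T' : Finset α} {f : α → V} {g : α → W}
    (h : FiberBound d T f g) (hT : T' ⊆ T) : FiberBound d T' f g := fun v =>
  (Finset.card_le_card (Finset.image_subset_image (Finset.filter_subset_filter _ hT))).trans (h v)

theorem FiberBound.card_image_pair_le {d : ℕ} {T : Finset α} {f : α → V} {g : α → W}
    (h : FiberBound d T g f) :
    (T.image fun t => (f t, g t)).card ≤ d * (T.image g).card := by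
  have himg : (T.image fun t => (f t, g t)).image Prod.snd = T.image g := by
    rw [Finset.image_image]; rfl
  rw [← himg]
  refine Finset.card_le_mul_card_image _ _ fun v _ => le_trans ?_ (h v)
  refine Finset.card_le_card_of_injOn Prod.fst ?_ ?_
  · rintro ⟨a, b⟩ hab
    simp only [Finset.coe_filter, Finset.mem_image, Set.mem_ofPred_eq, Prod.mk.injEq] at hab
    obtain ⟨⟨t, ht, rfl, rfl⟩, rfl⟩ := hab
    exact Finset.mem_coe.2 (Finset.mem_image_of_mem _ (Finset.mem_filter.2 ⟨ht, rfl⟩))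
  · rintro ⟨a, b⟩ hab ⟨a', b'⟩ hab' haa
    have h1 := (Finset.mem_filter.1 (Finset.mem_coe.1 hab)).2
    have h2 := (Finset.mem_filter.1 (Finset.mem_coe.1 hab')).2
    exact Prod.ext haa (h1.trans h2.symm)

theorem sum_card_fiber_image_le (T : Finset α) (f : α → V) (g : α → W) :
    ∑ v ∈ T.image f, ((T.filter fun t => f t = v).image g).card ≤
      (T.image fun t => (f t, g t)).card := by
  rw [Finset.card_eq_sum_card_fiberwise (f := Prod.fst) (t := T.image f)
    (s := T.image fun t => (f t, g t))]
  · refine Finset.sum_le_sum fun v _ => ?_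
    refine Finset.card_le_card_of_injOn (fun w => (v, w)) ?_ ?_
    · intro w hw
      obtain ⟨t, ht, rfl⟩ := Finset.mem_image.1 (Finset.mem_coe.1 hw)
      obtain ⟨htT, rfl⟩ := Finset.mem_filter.1 ht
      exact Finset.mem_coe.2 (Finset.mem_filter.2
        ⟨Finset.mem_image_of_mem (fun t => (f t, g t)) htT, rfl⟩)
    · intro a _ b _ hab
      exact (Prod.mk.inj hab).2
  · intro w hw
    obtain ⟨t, ht, rfl⟩ := Finset.mem_image.1 (Finset.mem_coe.1 hw)
    exact Finset.mem_coe.2 (Finset.mem_image_of_mem _ ht)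

theorem card_le_card_image_mul_card_image {T : Finset α} {q : α → V} {r : α → W}
    (hinj : ∀ s ∈ T, ∀ t ∈ T, q s = q t → r s = r t → s = t) :
    T.card ≤ (T.image q).card * (T.image r).card := by
  rw [← Finset.card_product]
  refine Finset.card_le_card_of_injOn (fun t => (q t, r t)) ?_ ?_
  · intro t ht
    exact Finset.mem_coe.2 (Finset.mem_product.2
      ⟨Finset.mem_image_of_mem _ ht, Finset.mem_image_of_mem _ ht⟩)
  · intro s hs t ht hst
    exact hinj s hs t ht (Prod.mk.inj hst).1 (Prod.mk.inj hst).2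

/-- If a set of at least `L` points has at most `d²` pairs of projections to `(p, q)` and to
`(p, r)`, then some `d` fibres of `p` together contain many points. -/
theorem exists_heavy_fibers {d : ℕ} (hd : 1 ≤ d) {T : Finset α} {p : α → V} {q : α → W}
    {r : α → X} (hinj : ∀ s t, p s = p t → q s = q t → r s = r t → s = t)
    (hq : (T.image fun t => (p t, q t)).card ≤ d * d)
    (hr : (T.image fun t => (p t, r t)).card ≤ d * d)
    {L : ℝ} (hL0 : 0 ≤ L) (hL : L ≤ T.card) (hLd : L ≤ (d : ℝ) ^ 3) :
    ∃ P ⊆ T.image p, P.card ≤ d ∧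
      L ^ 2 / (4 * (d : ℝ) ^ 3) ≤ ((T.filter fun t => p t ∈ P).card : ℝ) := by
  have hd0 : (0 : ℝ) < d := by exact_mod_cast hd
  set F : V → Finset α := fun i => T.filter fun t => p t = i with hF
  -- The threshold `s ^ 2` balances two demands: fibres below it hold at most `L / 2` points in
  -- total, and `d` fibres above it already reach the target, as `d * s ^ 2 = L ^ 2 / (4 * d ^ 3)`.
  set s : ℝ := L / (2 * (d : ℝ) ^ 2) with hs
  have hs0 : 0 ≤ s := by positivity
  set H : Finset V := (T.image p).filter fun i => s ^ 2 ≤ ((F i).card : ℝ) with hH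
  have hcount : ∀ P : Finset V, ((T.filter fun t => p t ∈ P).card : ℝ) =
      ∑ i ∈ P, ((F i).card : ℝ) := by
    intro P
    rw [Finset.card_eq_sum_card_fiberwise (f := p) (t := P)]
    · push_cast
      refine Finset.sum_congr rfl fun i hi => ?_
      congr 2
      ext t
      simp only [hF, Finset.mem_filter]
      constructor
      · rintro ⟨⟨h1, _⟩, h2⟩; exact ⟨h1, h2⟩
      · rintro ⟨h1, rfl⟩; exact ⟨⟨h1, hi⟩, rfl⟩
    · intro t ht
      exact (Finset.mem_filter.1 (Finset.mem_coe.1 ht)).2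
  have htotal : (T.card : ℝ) = ∑ i ∈ T.image p, ((F i).card : ℝ) := by
    rw [← hcount]
    congr 2
    exact (Finset.filter_true_of_mem fun t ht => Finset.mem_image_of_mem _ ht).symm
  have hlight : ∑ i ∈ (T.image p).filter (fun i => ¬ s ^ 2 ≤ ((F i).card : ℝ)),
      ((F i).card : ℝ) ≤ L / 2 := by
    -- A light fibre satisfies both `|F| < s²` and `|F| ≤ a * b`, so `|F| ≤ s √(ab) ≤ s (a + b) /
    -- 2`. This is linear in the projection sizes, whose sums are bounded.
    have hterm : ∀ i ∈ (T.image p).filter (fun i => ¬ s ^ 2 ≤ ((F i).card : ℝ)),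
        ((F i).card : ℝ) ≤
          s / 2 * ((((F i).image q).card : ℝ) + (((F i).image r).card : ℝ)) := by
      intro i hi
      have hlt := not_le.1 (Finset.mem_filter.1 hi).2
      have hle : (F i).card ≤ ((F i).image q).card * ((F i).image r).card := by
        refine card_le_card_image_mul_card_image fun a ha b hb => hinj a b ?_
        exact (Finset.mem_filter.1 ha).2.trans (Finset.mem_filter.1 hb).2.symm
      have hle' : ((F i).card : ℝ) ≤ ((F i).image q).card * ((F i).image r).card := by
        exact_mod_cast hle
      set a : ℝ := (((F i).image q).card : ℝ)
      set b : ℝ := (((F i).image r).card : ℝ)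
      have ha : 0 ≤ a := Nat.cast_nonneg _
      have hb : 0 ≤ b := Nat.cast_nonneg _
      have hf : (0 : ℝ) ≤ (F i).card := Nat.cast_nonneg _
      refine (sq_le_sq₀ hf (by positivity)).1 ?_
      calc ((F i).card : ℝ) ^ 2 = (F i).card * (F i).card := sq _
        _ ≤ s ^ 2 * (a * b) := mul_le_mul hlt.le hle' hf (sq_nonneg s)
        _ ≤ (s / 2 * (a + b)) ^ 2 := by nlinarith [mul_nonneg (sq_nonneg s) (sq_nonneg (a - b))]
    have ha := (sum_card_fiber_image_le T p q).trans hq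
    have hb := (sum_card_fiber_image_le T p r).trans hr
    have ha' : ∑ i ∈ T.image p, (((F i).image q).card : ℝ) ≤ (d : ℝ) * d := by exact_mod_cast ha
    have hb' : ∑ i ∈ T.image p, (((F i).image r).card : ℝ) ≤ (d : ℝ) * d := by exact_mod_cast hb
    calc _ ≤ ∑ i ∈ (T.image p).filter (fun i => ¬ s ^ 2 ≤ ((F i).card : ℝ)),
          s / 2 * ((((F i).image q).card : ℝ) + (((F i).image r).card : ℝ)) :=
        Finset.sum_le_sum hterm
      _ ≤ ∑ i ∈ T.image p, s / 2 * ((((F i).image q).card : ℝ) + (((F i).image r).card : ℝ)) :=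
        Finset.sum_le_sum_of_subset_of_nonneg (Finset.filter_subset _ _)
          fun i _ _ => by positivity
      _ = s / 2 * (∑ i ∈ T.image p, (((F i).image q).card : ℝ) +
            ∑ i ∈ T.image p, (((F i).image r).card : ℝ)) := by
        rw [← Finset.mul_sum, Finset.sum_add_distrib]
      _ ≤ s / 2 * ((d : ℝ) * d + d * d) := by gcongr
      _ = L / 2 := by rw [hs]; field_simp; ring
  have hheavy : L / 2 ≤ ∑ i ∈ H, ((F i).card : ℝ) := by
    have := Finset.sum_filter_add_sum_filter_not (T.image p)
      (fun i => s ^ 2 ≤ ((F i).card : ℝ)) (fun i => ((F i).card : ℝ))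
    linarith
  have hHsub : H ⊆ T.image p := Finset.filter_subset _ _
  -- With at most `d` heavy fibres all are taken, and `L ≤ d ^ 3` makes `L / 2` enough; otherwise
  -- any `d` of them suffice.
  rcases le_or_gt H.card d with hcard | hcard
  · refine ⟨H, hHsub, hcard, ?_⟩
    rw [hcount]
    refine le_trans ?_ hheavy
    rw [div_le_div_iff₀ (by positivity) (by norm_num)]
    nlinarith [mul_le_mul_of_nonneg_left hLd hL0, mul_nonneg hL0 hL0]
  · obtain ⟨P, hPH, hP⟩ := Finset.exists_subset_card_eq hcard.le
    refine ⟨P, hPH.trans hHsub, hP.le, ?_⟩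
    rw [hcount]
    calc L ^ 2 / (4 * (d : ℝ) ^ 3) = ∑ _i ∈ P, s ^ 2 := by
          rw [Finset.sum_const, hP, nsmul_eq_mul, hs]; field_simp; ring
      _ ≤ ∑ i ∈ P, ((F i).card : ℝ) :=
        Finset.sum_le_sum fun i hi => (Finset.mem_filter.1 (hPH hi)).2

/-- If all pairs of projections `(q, r)` have codegree at least `τ`, then the neighbourhood of a
point `x` gives a cluster containing many points of `T`. -/
theorem exists_dense_cluster {d : ℕ} (hd : 1 ≤ d) {T : Finset α} {p : α → V} {q : α → W}
    {r : α → X} (hinj : ∀ s t, p s = p t → q s = q t → r s = r t → s = t)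
    (hpq : FiberBound d T p q) (hpr : FiberBound d T p r)
    (hqp : FiberBound d T q p) (hrp : FiberBound d T r p)
    {τ : ℝ} (hτ0 : 0 ≤ τ) (hτd : τ ≤ d)
    (hτ : ∀ t ∈ T, τ ≤ ((T.filter fun s => q s = q t ∧ r s = r t).card : ℝ))
    (x : V) :
    ∃ P ⊆ T.image p, ∃ Q ⊆ T.image q, ∃ R ⊆ T.image r, P.card ≤ d ∧ Q.card ≤ d ∧ R.card ≤ d ∧
      (((T.filter fun t => p t = x).card : ℝ) * τ) ^ 2 / (4 * (d : ℝ) ^ 3) ≤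
        ((T.filter fun t => p t ∈ P ∧ q t ∈ Q ∧ r t ∈ R).card : ℝ) := by
  classical
  set N : Finset α := T.filter fun t => p t = x with hN
  have hNT : N ⊆ T := Finset.filter_subset _ _
  set W' : Finset α := T.filter fun t => q t ∈ N.image q ∧ r t ∈ N.image r with hW
  have hWT : W' ⊆ T := Finset.filter_subset _ _
  have hWq : W'.image q ⊆ N.image q := by
    intro v hv
    obtain ⟨t, ht, rfl⟩ := Finset.mem_image.1 hv
    exact (Finset.mem_filter.1 ht).2.1
  have hWr : W'.image r ⊆ N.image r := by
    intro v hv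
    obtain ⟨t, ht, rfl⟩ := Finset.mem_image.1 hv
    exact (Finset.mem_filter.1 ht).2.2
  have hNinj : ∀ s ∈ N, ∀ t ∈ N, q s = q t → r s = r t → s = t := fun s hs t ht =>
    hinj s t ((Finset.mem_filter.1 hs).2.trans (Finset.mem_filter.1 ht).2.symm)
  have hNcard : (N.card : ℝ) ≤ (d : ℝ) ^ 2 := by
    have := (card_le_card_image_mul_card_image hNinj).trans (Nat.mul_le_mul (hpq x) (hpr x))
    rw [sq]; exact_mod_cast this
  -- Distinct points of the link of `x` have distinct `(q, r)` pairs, so the sets counted by their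
  -- codegrees are disjoint.
  have hWcard : (N.card : ℝ) * τ ≤ W'.card := by
    have hle : ∑ t ∈ N, (T.filter fun s => q s = q t ∧ r s = r t).card ≤ W'.card := by
      rw [← Finset.card_biUnion]
      · refine Finset.card_le_card fun s hs => ?_
        obtain ⟨t, ht, hst⟩ := Finset.mem_biUnion.1 hs
        obtain ⟨hsT, h1, h2⟩ := Finset.mem_filter.1 hst
        exact Finset.mem_filter.2 ⟨hsT, h1 ▸ Finset.mem_image_of_mem _ ht,
          h2 ▸ Finset.mem_image_of_mem _ ht⟩
      · intro s hs t ht hne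
        refine Finset.disjoint_left.2 fun u hu hu' => hne ?_
        obtain ⟨-, h1, h2⟩ := Finset.mem_filter.1 hu
        obtain ⟨-, h3, h4⟩ := Finset.mem_filter.1 hu'
        exact hNinj s hs t ht (h1.symm.trans h3) (h2.symm.trans h4)
    calc (N.card : ℝ) * τ = ∑ _t ∈ N, τ := by rw [Finset.sum_const, nsmul_eq_mul]
      _ ≤ ∑ t ∈ N, ((T.filter fun s => q s = q t ∧ r s = r t).card : ℝ) :=
        Finset.sum_le_sum fun t ht => hτ t (hNT ht)
      _ ≤ W'.card := by exact_mod_cast hle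
  have hq2 : (W'.image fun t => (p t, q t)).card ≤ d * d :=
    (hqp.mono hWT).card_image_pair_le.trans
      (Nat.mul_le_mul_left _ ((Finset.card_le_card hWq).trans (hpq x)))
  have hr2 : (W'.image fun t => (p t, r t)).card ≤ d * d :=
    (hrp.mono hWT).card_image_pair_le.trans
      (Nat.mul_le_mul_left _ ((Finset.card_le_card hWr).trans (hpr x)))
  obtain ⟨P, hPsub, hPcard, hP⟩ := exists_heavy_fibers hd hinj hq2 hr2
    (L := (N.card : ℝ) * τ) (by positivity) hWcard
    (by calc (N.card : ℝ) * τ ≤ (d : ℝ) ^ 2 * d := by gcongr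
          _ = (d : ℝ) ^ 3 := by ring)
  refine ⟨P, hPsub.trans (Finset.image_subset_image hWT), N.image q,
    Finset.image_subset_image hNT, N.image r, Finset.image_subset_image hNT, hPcard, hpq x,
    hpr x, hP.trans ?_⟩
  refine Nat.cast_le.2 (Finset.card_le_card fun t ht => ?_)
  obtain ⟨htW, htP⟩ := Finset.mem_filter.1 ht
  obtain ⟨htT, h⟩ := Finset.mem_filter.1 htW
  exact Finset.mem_filter.2 ⟨htT, htP, h⟩

end Projections

end SparseMM

namespace SparseMM

/-! ### Cleaning by maximising a potential -/

section Potential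

variable {α β : Type*} [DecidableEq β]

/-- The number of points of `T`, with a charge of `τ` for each of their projections. -/
noncomputable def potential (τ : ℝ) (e₁ e₂ e₃ : α → β) (T : Finset α) : ℝ :=
  T.card - τ * ((T.image e₁).card + (T.image e₂).card + (T.image e₃).card)

theorem potential_le_card {τ : ℝ} (hτ : 0 ≤ τ) (e₁ e₂ e₃ : α → β) (T : Finset α) :
    potential τ e₁ e₂ e₃ T ≤ T.card := by
  unfold potential
  have : 0 ≤ τ * (((T.image e₁).card : ℝ) + (T.image e₂).card + (T.image e₃).card) := by positivity
  linarith

/-- Shrinking the set can only lower the charge for projections. -/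
theorem potential_sub_le {τ : ℝ} (hτ : 0 ≤ τ) (e₁ e₂ e₃ : α → β) {T T' : Finset α}
    (h : T' ⊆ T) :
    potential τ e₁ e₂ e₃ T - potential τ e₁ e₂ e₃ T' ≤ (T.card : ℝ) - T'.card := by
  have h' : ∀ e : α → β, ((T'.image e).card : ℝ) ≤ (T.image e).card := fun e =>
    Nat.cast_le.2 (Finset.card_le_card (Finset.image_subset_image h))
  have := mul_le_mul_of_nonneg_left (add_le_add (add_le_add (h' e₁) (h' e₂)) (h' e₃)) hτ
  unfold potential
  linarith

theorem card_image_filter_ne_add_one_le {T : Finset α} (e : α → β) {t : α} (ht : t ∈ T) :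
    ((T.filter fun s => e s ≠ e t).image e).card + 1 ≤ (T.image e).card := by
  have hmem : e t ∉ (T.filter fun s => e s ≠ e t).image e := by
    intro h
    obtain ⟨s, hs, hst⟩ := Finset.mem_image.1 h
    exact (Finset.mem_filter.1 hs).2 hst
  rw [← Finset.card_insert_of_notMem hmem]
  refine Finset.card_le_card (Finset.insert_subset (Finset.mem_image_of_mem _ ht) ?_)
  exact Finset.image_subset_image (Finset.filter_subset _ _)

/-- A subset that maximises the potential has at least `τ` points over each projection. -/
theorem exists_subset_le_card_fiber {τ : ℝ} (hτ : 0 ≤ τ) (e₁ e₂ e₃ : α → β) (T : Finset α) :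
    ∃ T' ⊆ T, potential τ e₁ e₂ e₃ T ≤ potential τ e₁ e₂ e₃ T' ∧ ∀ t ∈ T',
      τ ≤ ((T'.filter fun s => e₁ s = e₁ t).card : ℝ) ∧
      τ ≤ ((T'.filter fun s => e₂ s = e₂ t).card : ℝ) ∧
      τ ≤ ((T'.filter fun s => e₃ s = e₃ t).card : ℝ) := by
  obtain ⟨T', hT', hmax⟩ := Finset.exists_max_image T.powerset (potential τ e₁ e₂ e₃)
    ⟨T, Finset.mem_powerset_self T⟩
  rw [Finset.mem_powerset] at hT'
  refine ⟨T', hT', hmax T (Finset.mem_powerset_self T), fun t ht => ?_⟩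
  -- Deleting a whole fibre refunds at least `τ`; by maximality it must lose at least as many
  -- points.
  have hkey : ∀ e : α → β,
      potential τ e₁ e₂ e₃ (T'.filter fun s => e s ≠ e t) ≤ potential τ e₁ e₂ e₃ T' := fun e =>
    hmax _ (Finset.mem_powerset.2 ((Finset.filter_subset _ _).trans hT'))
  have hcard : ∀ e : α → β, (T'.card : ℝ) = ((T'.filter fun s => e s = e t).card : ℝ) +
      ((T'.filter fun s => e s ≠ e t).card : ℝ) := fun e => by
    exact_mod_cast (Finset.card_filter_add_card_filter_not (s := T') (fun s => e s = e t)).symm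
  have hdrop : ∀ e : α → β, (((T'.filter fun s => e s ≠ e t).image e).card : ℝ) + 1 ≤
      (T'.image e).card := fun e => by
    exact_mod_cast card_image_filter_ne_add_one_le e ht
  have hmono : ∀ e e' : α → β, (((T'.filter fun s => e s ≠ e t).image e').card : ℝ) ≤
      (T'.image e').card := fun e e' =>
    Nat.cast_le.2 (Finset.card_le_card (Finset.image_subset_image (Finset.filter_subset _ _)))
  unfold potential at hkey
  refine ⟨?_, ?_, ?_⟩
  · have := mul_le_mul_of_nonneg_left
      (add_le_add (add_le_add (hdrop e₁) (hmono e₁ e₂)) (hmono e₁ e₃)) hτ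
    linarith [hkey e₁, hcard e₁]
  · have := mul_le_mul_of_nonneg_left
      (add_le_add (add_le_add (hmono e₂ e₁) (hdrop e₂)) (hmono e₂ e₃)) hτ
    linarith [hkey e₂, hcard e₂]
  · have := mul_le_mul_of_nonneg_left
      (add_le_add (add_le_add (hmono e₃ e₁) (hmono e₃ e₂)) (hdrop e₃)) hτ
    linarith [hkey e₃, hcard e₃]

end Potential

/-! ### Disjoint families of `d`-sets -/

section Packing

/-- A family of pairwise disjoint sets of size `d`. -/
def IsPacking {n m : ℕ} (d : ℕ) (F : Fin m → Finset (Fin n)) : Prop :=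
  (∀ a, (F a).card = d) ∧ ∀ a b, a ≠ b → Disjoint (F a) (F b)

/-- The earlier sets occupy `m * d` vertices, which leaves at least `d` free ones to pad `P` to size
exactly `d`. -/
theorem IsPacking.exists_snoc {n m d : ℕ} {F : Fin m → Finset (Fin n)} (hF : IsPacking d F)
    (hn : (m + 1) * d ≤ n) {P : Finset (Fin n)} (hP : P.card ≤ d)
    (hPF : ∀ a, Disjoint P (F a)) :
    ∃ P', P ⊆ P' ∧ P'.card = d ∧ IsPacking d (Fin.snoc F P' : Fin (m + 1) → Finset (Fin n)) := by
  have hU : (Finset.univ.biUnion F).card ≤ m * d := by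
    calc _ ≤ ∑ a : Fin m, (F a).card := Finset.card_biUnion_le
      _ = m * d := by simp [hF.1]
  have hsub : P ⊆ (Finset.univ.biUnion F)ᶜ := by
    intro v hv
    rw [Finset.mem_compl, Finset.mem_biUnion]
    rintro ⟨a, -, ha⟩
    exact Finset.disjoint_left.1 (hPF a) hv ha
  have hroom : d ≤ (Finset.univ.biUnion F)ᶜ.card := by
    rw [Finset.card_compl, Fintype.card_fin]
    have : (m + 1) * d = m * d + d := by ring
    omega
  obtain ⟨P', hPP', hP'sub, hP'card⟩ := Finset.exists_subsuperset_card_eq hsub hP hroom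
  have hdisj : ∀ a, Disjoint P' (F a) := fun a =>
    Finset.disjoint_left.2 fun v hv hva =>
      Finset.mem_compl.1 (hP'sub hv) (Finset.mem_biUnion.2 ⟨a, Finset.mem_univ _, hva⟩)
  refine ⟨P', hPP', hP'card, ?_, ?_⟩
  · intro a
    refine Fin.lastCases ?_ (fun a => ?_) a
    · simpa using hP'card
    · simpa using hF.1 a
  · intro a b
    refine Fin.lastCases ?_ (fun a => ?_) a <;> refine Fin.lastCases ?_ (fun b => ?_) b
    · intro h; exact absurd rfl h
    · intro _; simpa using hdisj b
    · intro _; simpa using (hdisj a).symm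
    · intro h
      simpa using hF.2 a b fun hab => h (by rw [hab])

end Packing

/-! ### Sparse sets of triples -/

section Triples

variable {n : ℕ}

/-- In each coordinate direction, a vertex meets at most `d` vertices of each other part. -/
def SparseTriples (d : ℕ) (T : Finset (Term n)) : Prop :=
  FiberBound d T (fun t => t.1) (fun t => t.2.1) ∧ FiberBound d T (fun t => t.1) (fun t => t.2.2) ∧
  FiberBound d T (fun t => t.2.1) (fun t => t.1) ∧
  FiberBound d T (fun t => t.2.1) (fun t => t.2.2) ∧
  FiberBound d T (fun t => t.2.2) (fun t => t.1) ∧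
  FiberBound d T (fun t => t.2.2) (fun t => t.2.1)

theorem SparseTriples.mono {d : ℕ} {T T' : Finset (Term n)} (h : SparseTriples d T)
    (hT : T' ⊆ T) : SparseTriples d T' :=
  ⟨h.1.mono hT, h.2.1.mono hT, h.2.2.1.mono hT, h.2.2.2.1.mono hT, h.2.2.2.2.1.mono hT,
    h.2.2.2.2.2.mono hT⟩

/-- The potential of a set of triples, charging for each pair of coordinates that occurs. -/
noncomputable abbrev pairPotential (τ : ℝ) (T : Finset (Term n)) : ℝ :=
  potential τ (fun t : Term n => (t.2.1, t.2.2)) (fun t => (t.2.2, t.1)) (fun t => (t.1, t.2.1)) T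

theorem SparseTriples.le_pairPotential {d : ℕ} {T : Finset (Term n)} (h : SparseTriples d T)
    {τ : ℝ} (hτ : 0 ≤ τ) : (T.card : ℝ) - τ * (3 * (d * n)) ≤ pairPotential τ T := by
  have hn : ∀ S : Finset (Fin n), d * S.card ≤ d * n := fun S =>
    Nat.mul_le_mul_left _ ((Finset.card_le_univ S).trans_eq (Fintype.card_fin n))
  have h1 : ((T.image fun t => (t.2.1, t.2.2)).card : ℝ) ≤ d * n := by
    exact_mod_cast (h.2.2.2.2.2.card_image_pair_le).trans (hn _)
  have h2 : ((T.image fun t => (t.2.2, t.1)).card : ℝ) ≤ d * n := by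
    exact_mod_cast (h.2.1.card_image_pair_le).trans (hn _)
  have h3 : ((T.image fun t => (t.1, t.2.1)).card : ℝ) ≤ d * n := by
    exact_mod_cast (h.2.2.1.card_image_pair_le).trans (hn _)
  have := mul_le_mul_of_nonneg_left (add_le_add (add_le_add h1 h2) h3) hτ
  unfold pairPotential potential
  linarith

/-- The points of `T` inside the cluster `P × Q × R`. -/
def inCluster (T : Finset (Term n)) (P Q R : Finset (Fin n)) : Finset (Term n) :=
  T.filter fun t => t.1 ∈ P ∧ t.2.1 ∈ Q ∧ t.2.2 ∈ R

/-- In a set of triples all of whose pairs have codegree at least `τ` there is a cluster that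
contains many triples compared with the maximum degree. -/
theorem exists_dense_cluster_of_le_card {d : ℕ} (hd : 1 ≤ d) (hn : 1 ≤ n) {T : Finset (Term n)}
    (hT : SparseTriples d T) {τ : ℝ} (hτ0 : 0 ≤ τ) (hτd : τ ≤ d)
    (hτ : ∀ t ∈ T, τ ≤ ((T.filter fun s => (s.2.1, s.2.2) = (t.2.1, t.2.2)).card : ℝ) ∧
      τ ≤ ((T.filter fun s => (s.2.2, s.1) = (t.2.2, t.1)).card : ℝ) ∧
      τ ≤ ((T.filter fun s => (s.1, s.2.1) = (t.1, t.2.1)).card : ℝ))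
    {D : ℝ} (hD : n * D ≤ T.card) :
    ∃ Δ : ℕ, D ≤ Δ ∧ (∀ v, (T.filter fun t => t.1 = v).card ≤ Δ) ∧
      (∀ v, (T.filter fun t => t.2.1 = v).card ≤ Δ) ∧
      (∀ v, (T.filter fun t => t.2.2 = v).card ≤ Δ) ∧
      ∃ P ⊆ T.image (fun t => t.1), ∃ Q ⊆ T.image (fun t => t.2.1),
        ∃ R ⊆ T.image (fun t => t.2.2), P.card ≤ d ∧ Q.card ≤ d ∧ R.card ≤ d ∧
          ((Δ : ℝ) * τ) ^ 2 / (4 * (d : ℝ) ^ 3) ≤ ((inCluster T P Q R).card : ℝ) := by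
  set f₁ : Fin n → ℕ := fun v => (T.filter fun t => t.1 = v).card with hf₁
  set f₂ : Fin n → ℕ := fun v => (T.filter fun t => t.2.1 = v).card with hf₂
  set f₃ : Fin n → ℕ := fun v => (T.filter fun t => t.2.2 = v).card with hf₃
  obtain ⟨x, -, hx⟩ := Finset.exists_max_image Finset.univ
    (fun v => max (f₁ v) (max (f₂ v) (f₃ v))) ⟨⟨0, hn⟩, Finset.mem_univ _⟩
  set Δ : ℕ := max (f₁ x) (max (f₂ x) (f₃ x)) with hΔ
  have h1 : ∀ v, f₁ v ≤ Δ := fun v => (le_max_left _ _).trans (hx v (Finset.mem_univ _))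
  have h2 : ∀ v, f₂ v ≤ Δ := fun v =>
    ((le_max_left _ _).trans (le_max_right _ _)).trans (hx v (Finset.mem_univ _))
  have h3 : ∀ v, f₃ v ≤ Δ := fun v =>
    ((le_max_right _ _).trans (le_max_right _ _)).trans (hx v (Finset.mem_univ _))
  refine ⟨Δ, ?_, h1, h2, h3, ?_⟩
  · have hsum : T.card ≤ n * Δ := by
      rw [Finset.card_eq_sum_card_fiberwise (f := fun t : Term n => t.1) (t := Finset.univ)
        fun _ _ => Finset.mem_coe.2 (Finset.mem_univ _)]
      exact (Finset.sum_le_card_nsmul _ _ Δ fun v _ => h1 v).trans_eq (by simp)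
    have hsum' : (T.card : ℝ) ≤ n * Δ := by exact_mod_cast hsum
    exact le_of_mul_le_mul_left (hD.trans hsum') (by exact_mod_cast hn)
  · simp only [Prod.mk.injEq] at hτ
    obtain ⟨h12, h13, h21, h23, h31, h32⟩ := hT
    have hcase : Δ = f₁ x ∨ Δ = f₂ x ∨ Δ = f₃ x := by
      rcases max_choice (f₁ x) (max (f₂ x) (f₃ x)) with h | h
      · exact Or.inl h
      · rcases max_choice (f₂ x) (f₃ x) with h' | h'
        · exact Or.inr (Or.inl (h.trans h'))
        · exact Or.inr (Or.inr (h.trans h'))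
    -- The maximum degree may occur in any part; the three cases are cyclic rotations of the
    -- coordinates.
    rcases hcase with h | h | h <;> rw [h]
    · obtain ⟨P, hP, Q, hQ, R, hR, cP, cQ, cR, hc⟩ := exists_dense_cluster hd
        (fun s t h1 h2 h3 => Prod.ext h1 (Prod.ext h2 h3)) h12 h13 h21 h31 hτ0 hτd
        (fun t ht => (hτ t ht).1) x
      exact ⟨P, hP, Q, hQ, R, hR, cP, cQ, cR, hc⟩
    · obtain ⟨Q, hQ, R, hR, P, hP, cQ, cR, cP, hc⟩ := exists_dense_cluster hd
        (fun s t h2 h3 h1 => Prod.ext h1 (Prod.ext h2 h3)) h23 h21 h32 h12 hτ0 hτd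
        (fun t ht => (hτ t ht).2.1) x
      refine ⟨P, hP, Q, hQ, R, hR, cP, cQ, cR, hc.trans_eq ?_⟩
      congr 2
      ext t
      simp only [inCluster, Finset.mem_filter]
      tauto
    · obtain ⟨R, hR, P, hP, Q, hQ, cR, cP, cQ, hc⟩ := exists_dense_cluster hd
        (fun s t h3 h1 h2 => Prod.ext h1 (Prod.ext h2 h3)) h31 h32 h13 h23 hτ0 hτd
        (fun t ht => (hτ t ht).2.2) x
      refine ⟨P, hP, Q, hQ, R, hR, cP, cQ, cR, hc.trans_eq ?_⟩
      congr 2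
      ext t
      simp only [inCluster, Finset.mem_filter]
      tauto

/-! ### Greedy packing of clusters -/

/-- The triples outside all three parts of a cluster. -/
def avoiding (T : Finset (Term n)) (P Q R : Finset (Fin n)) : Finset (Term n) :=
  T.filter fun t => t.1 ∉ P ∧ t.2.1 ∉ Q ∧ t.2.2 ∉ R

theorem avoiding_subset (T : Finset (Term n)) (P Q R : Finset (Fin n)) : avoiding T P Q R ⊆ T :=
  Finset.filter_subset _ _

theorem card_filter_mem_le {α β : Type*} [DecidableEq β] (T : Finset α) (f : α → β)
    (P : Finset β) {Δ : ℕ} (h : ∀ v, (T.filter fun t => f t = v).card ≤ Δ) :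
    (T.filter fun t => f t ∈ P).card ≤ P.card * Δ := by
  classical
  have hsub : (T.filter fun t => f t ∈ P) ⊆ P.biUnion fun v => T.filter fun t => f t = v := by
    intro t ht
    obtain ⟨htT, htP⟩ := Finset.mem_filter.1 ht
    exact Finset.mem_biUnion.2 ⟨f t, htP, Finset.mem_filter.2 ⟨htT, rfl⟩⟩
  exact (Finset.card_le_card hsub).trans (Finset.card_biUnion_le_card_mul _ _ _ fun v _ => h v)

theorem card_le_card_avoiding_add {d Δ : ℕ} {T : Finset (Term n)} {P Q R : Finset (Fin n)}
    (hP : P.card = d) (hQ : Q.card = d) (hR : R.card = d)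
    (h1 : ∀ v, (T.filter fun t => t.1 = v).card ≤ Δ)
    (h2 : ∀ v, (T.filter fun t => t.2.1 = v).card ≤ Δ)
    (h3 : ∀ v, (T.filter fun t => t.2.2 = v).card ≤ Δ) :
    T.card ≤ (avoiding T P Q R).card + 3 * (d * Δ) := by
  have hsub : T ⊆ avoiding T P Q R ∪ ((T.filter fun t => t.1 ∈ P) ∪
      ((T.filter fun t => t.2.1 ∈ Q) ∪ (T.filter fun t => t.2.2 ∈ R))) := by
    intro t ht
    simp only [avoiding, Finset.mem_union, Finset.mem_filter, ht, true_and]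
    tauto
  have b1 := card_filter_mem_le T (fun t => t.1) P h1
  have b2 := card_filter_mem_le T (fun t => t.2.1) Q h2
  have b3 := card_filter_mem_le T (fun t => t.2.2) R h3
  rw [hP] at b1
  rw [hQ] at b2
  rw [hR] at b3
  have c0 := Finset.card_le_card hsub
  have c1 := Finset.card_union_le (avoiding T P Q R) ((T.filter fun t => t.1 ∈ P) ∪
      ((T.filter fun t => t.2.1 ∈ Q) ∪ (T.filter fun t => t.2.2 ∈ R)))
  have c2 := Finset.card_union_le (T.filter fun t => t.1 ∈ P)
      ((T.filter fun t => t.2.1 ∈ Q) ∪ (T.filter fun t => t.2.2 ∈ R))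
  have c3 := Finset.card_union_le (T.filter fun t => t.2.1 ∈ Q) (T.filter fun t => t.2.2 ∈ R)
  omega

/-- The triples inside one of a family of clusters. -/
def inClusters {m : ℕ} (T : Finset (Term n)) (F G H : Fin m → Finset (Fin n)) :
    Finset (Term n) :=
  T.filter fun t => ∃ a, t.1 ∈ F a ∧ t.2.1 ∈ G a ∧ t.2.2 ∈ H a

theorem inClusters_subset_snoc {m : ℕ} (T : Finset (Term n)) (F G H : Fin m → Finset (Fin n))
    (P Q R : Finset (Fin n)) :
    inClusters T F G H ⊆ inClusters (m := m + 1) T (Fin.snoc F P) (Fin.snoc G Q)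
      (Fin.snoc H R) := by
  intro t ht
  obtain ⟨htT, a, ha⟩ := Finset.mem_filter.1 ht
  exact Finset.mem_filter.2 ⟨htT, a.castSucc, by simpa using ha⟩

theorem inCluster_subset_snoc {m : ℕ} {T T' : Finset (Term n)} (hT' : T' ⊆ T)
    (F G H : Fin m → Finset (Fin n)) {P Q R P' Q' R' : Finset (Fin n)} (hP : P ⊆ P')
    (hQ : Q ⊆ Q') (hR : R ⊆ R') :
    inCluster T' P Q R ⊆ inClusters (m := m + 1) T (Fin.snoc F P') (Fin.snoc G Q')
      (Fin.snoc H R') := by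
  intro t ht
  obtain ⟨htT, h1, h2, h3⟩ := Finset.mem_filter.1 ht
  exact Finset.mem_filter.2 ⟨hT' htT, Fin.last m, by simpa using ⟨hP h1, hQ h2, hR h3⟩⟩

/-- Greedy choice of `m` disjoint clusters: either they contain at least `M` triples, or each of
them contributes at least `g` and the triples lost to the potential are at most `ρ⁻¹` times the
triples gained. -/
theorem exists_packing {d : ℕ} (hd : 1 ≤ d) (hn : 1 ≤ n) {T : Finset (Term n)}
    (hT : SparseTriples d T) {τ D g ρ M : ℝ} (hτ0 : 0 ≤ τ) (hτd : τ ≤ d) (hρ : 0 ≤ ρ)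
    (hg : ∀ Δ : ℕ, D ≤ Δ → g ≤ ((Δ : ℝ) * τ) ^ 2 / (4 * (d : ℝ) ^ 3))
    (hgρ : ∀ Δ : ℕ, D ≤ Δ → ρ * (3 * (d * Δ)) ≤ ((Δ : ℝ) * τ) ^ 2 / (4 * (d : ℝ) ^ 3))
    (hM : M ≤ ρ * (pairPotential τ T - n * D)) :
    ∀ m : ℕ, m * d ≤ n → ∃ F G H : Fin m → Finset (Fin n),
      IsPacking d F ∧ IsPacking d G ∧ IsPacking d H ∧
      (M ≤ ((inClusters T F G H).card : ℝ) ∨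
        m * g ≤ ((inClusters T F G H).card : ℝ) ∧
        ∃ T' ⊆ T, (∀ t ∈ T', ∀ a, t.1 ∉ F a ∧ t.2.1 ∉ G a ∧ t.2.2 ∉ H a) ∧
          ρ * (pairPotential τ T - pairPotential τ T') ≤ ((inClusters T F G H).card : ℝ)) := by
  intro m
  induction m with
  | zero =>
    intro _
    refine ⟨Fin.elim0, Fin.elim0, Fin.elim0, ⟨fun a => a.elim0, fun a => a.elim0⟩,
      ⟨fun a => a.elim0, fun a => a.elim0⟩, ⟨fun a => a.elim0, fun a => a.elim0⟩,
      Or.inr ⟨by simp, T, subset_rfl, fun t _ a => a.elim0, by simp⟩⟩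
  | succ m ih =>
    intro hm
    obtain ⟨F, G, H, hF, hG, hH, hor⟩ := ih ((Nat.mul_le_mul_right d (Nat.le_succ m)).trans hm)
    by_cases hdone : M ≤ ((inClusters T F G H).card : ℝ)
    -- Enough is computed already; the remaining clusters are arbitrary, obtained by padding the
    -- empty set.
    · obtain ⟨P, -, -, hP⟩ := hF.exists_snoc hm (P := ∅) (by simp) (by simp)
      obtain ⟨Q, -, -, hQ⟩ := hG.exists_snoc hm (P := ∅) (by simp) (by simp)
      obtain ⟨R, -, -, hR⟩ := hH.exists_snoc hm (P := ∅) (by simp) (by simp)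
      exact ⟨_, _, _, hP, hQ, hR, Or.inl (hdone.trans
        (Nat.cast_le.2 (Finset.card_le_card (inClusters_subset_snoc T F G H P Q R))))⟩
    obtain ⟨hgain, T', hT'T, havoid, hpot⟩ := hor.resolve_left hdone
    -- Were the potential below `n * D`, the triples gained so far would already number at least
    -- `M`.
    have hbig : n * D ≤ pairPotential τ T' := by
      by_contra hlt
      push Not at hlt hdone
      have := mul_le_mul_of_nonneg_left
        (sub_le_sub_left hlt.le (pairPotential τ T)) hρ
      linarith
    obtain ⟨U, hUT', hUpot, hU⟩ := exists_subset_le_card_fiber hτ0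
      (fun t : Term n => (t.2.1, t.2.2)) (fun t => (t.2.2, t.1)) (fun t => (t.1, t.2.1)) T'
    obtain ⟨Δ, hDΔ, h1, h2, h3, P, hP, Q, hQ, R, hR, cP, cQ, cR, hPQR⟩ :=
      exists_dense_cluster_of_le_card hd hn (hT.mono (hUT'.trans hT'T)) hτ0 hτd hU
        ((hbig.trans hUpot).trans (potential_le_card hτ0 _ _ _ _))
    obtain ⟨P', hPP', cP', hP'⟩ := hF.exists_snoc hm cP fun a =>
      Finset.disjoint_left.2 fun v hv hva => by
        obtain ⟨t, ht, rfl⟩ := Finset.mem_image.1 (hP hv)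
        exact (havoid t (hUT' ht) a).1 hva
    obtain ⟨Q', hQQ', cQ', hQ'⟩ := hG.exists_snoc hm cQ fun a =>
      Finset.disjoint_left.2 fun v hv hva => by
        obtain ⟨t, ht, rfl⟩ := Finset.mem_image.1 (hQ hv)
        exact (havoid t (hUT' ht) a).2.1 hva
    obtain ⟨R', hRR', cR', hR'⟩ := hH.exists_snoc hm cR fun a =>
      Finset.disjoint_left.2 fun v hv hva => by
        obtain ⟨t, ht, rfl⟩ := Finset.mem_image.1 (hR hv)
        exact (havoid t (hUT' ht) a).2.2 hva
    have hnew : ((inClusters T F G H).card : ℝ) + ((inCluster U P Q R).card : ℝ) ≤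
        ((inClusters (m := m + 1) T (Fin.snoc F P') (Fin.snoc G Q')
          (Fin.snoc H R')).card : ℝ) := by
      rw [← Nat.cast_add, ← Finset.card_union_of_disjoint]
      · exact Nat.cast_le.2 (Finset.card_le_card (Finset.union_subset
          (inClusters_subset_snoc T F G H P' Q' R')
          (inCluster_subset_snoc (hUT'.trans hT'T) F G H hPP' hQQ' hRR')))
      · refine Finset.disjoint_left.2 fun t ht ht' => ?_
        obtain ⟨-, a, ha, -⟩ := Finset.mem_filter.1 ht
        exact (havoid t (hUT' (Finset.mem_filter.1 ht').1) a).1 ha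
    refine ⟨_, _, _, hP', hQ', hR', Or.inr ⟨?_, avoiding U P' Q' R', ?_, ?_, ?_⟩⟩
    · push_cast
      linarith [hg Δ hDΔ]
    · exact (avoiding_subset _ _ _ _).trans (hUT'.trans hT'T)
    · intro t ht a
      obtain ⟨htU, hnot⟩ := Finset.mem_filter.1 ht
      refine Fin.lastCases ?_ (fun a => ?_) a
      · simpa using hnot
      · simpa using havoid t (hUT' htU) a
    -- Cleaning from `T'` to `U` does not lower the potential, so only the at most `3 * (d * Δ)`
    -- triples that meet the new cluster are charged.
    · have hloss := potential_sub_le hτ0 (fun t : Term n => (t.2.1, t.2.2))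
        (fun t => (t.2.2, t.1)) (fun t => (t.1, t.2.1))
        (avoiding_subset U P' Q' R')
      have hcard : (U.card : ℝ) ≤ (avoiding U P' Q' R').card + 3 * (d * Δ) := by
        exact_mod_cast card_le_card_avoiding_add cP' cQ' cR' h1 h2 h3
      have htot : pairPotential τ T - pairPotential τ (avoiding U P' Q' R') ≤
          (pairPotential τ T - pairPotential τ T') + 3 * (d * Δ) := by
        unfold pairPotential
        linarith
      have := mul_le_mul_of_nonneg_left htot hρ
      rw [mul_add] at this
      linarith [hgρ Δ hDΔ]

/-! ### One iteration and its repetition -/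

theorem Iteration.mem_uncomputed {d : ℕ} (L : Iteration n d) {T : Finset (Term n)} {t : Term n} :
    t ∈ L.uncomputed T ↔ t ∈ T ∧ ¬ L.Computes t := by
  simp [Iteration.uncomputed]

theorem Iteration.uncomputed_subset {d : ℕ} (L : Iteration n d) (T : Finset (Term n)) :
    L.uncomputed T ⊆ T := fun _ ht => (L.mem_uncomputed.1 ht).1

/-- A set of at least `θ d² n` triples has an iteration that computes `Ω(θ⁴ d² n)` of them. -/
theorem exists_iteration {d : ℕ} (hd : 1 ≤ d) (hdn : d ≤ n) {T : Finset (Term n)}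
    (hT : SparseTriples d T) {θ : ℝ} (hθ0 : 0 < θ) (hθ1 : θ ≤ 1)
    (hcard : θ * d ^ 2 * n ≤ T.card) :
    ∃ L : Iteration n d,
      ((L.uncomputed T).card : ℝ) + θ ^ 4 * d ^ 2 * n / 18432 ≤ T.card := by
  have hd0 : (0 : ℝ) < d := by exact_mod_cast hd
  have hn0 : (0 : ℝ) < n := by exact_mod_cast hd.trans hdn
  -- With this `τ` the charge for at most `3 d n` pairs is at most `θ d² n / 4`. As `n * D` is
  -- another `θ d² n / 4`, potential `θ d² n / 2` is left to spend. The values of `g` and `ρ` come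
  -- from putting `Δ = D` into the gain and into gain over cost.
  have hpot := hT.le_pairPotential (τ := θ * d / 12) (by positivity)
  obtain ⟨F, G, H, hF, hG, hH, hor⟩ := exists_packing hd (hd.trans hdn) hT
    (τ := θ * d / 12) (D := θ * d ^ 2 / 4) (g := θ ^ 4 * d ^ 3 / 9216) (ρ := θ ^ 3 / 6912)
    (M := θ ^ 4 * d ^ 2 * n / 13824) (by positivity) (by nlinarith) (by positivity)
    (fun Δ hΔ => by
      calc θ ^ 4 * (d : ℝ) ^ 3 / 9216
          = (θ * d ^ 2 / 4 * (θ * d / 12)) ^ 2 / (4 * (d : ℝ) ^ 3) := by field_simp; norm_num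
        _ ≤ _ := by gcongr)
    (fun Δ hΔ => by
      calc θ ^ 3 / 6912 * (3 * (d * (Δ : ℝ)))
          = Δ * (θ * d ^ 2 / 4) * (θ * d / 12) ^ 2 / (4 * (d : ℝ) ^ 3) := by field_simp; ring
        _ ≤ Δ * Δ * (θ * d / 12) ^ 2 / (4 * (d : ℝ) ^ 3) := by gcongr
        _ = _ := by ring)
    (by
      calc θ ^ 4 * (d : ℝ) ^ 2 * n / 13824 = θ ^ 3 / 6912 * (θ * d ^ 2 * n / 2) := by ring
        _ ≤ _ := by
          refine mul_le_mul_of_nonneg_left ?_ (by positivity)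
          linarith)
    (n / d) (Nat.div_mul_le_self n d)
  have hmany : θ ^ 4 * d ^ 2 * n / 18432 ≤ ((inClusters T F G H).card : ℝ) := by
    rcases hor with h | ⟨h, -⟩
    · refine le_trans ?_ h
      have : 0 ≤ θ ^ 4 * (d : ℝ) ^ 2 * n := by positivity
      linarith
    · refine le_trans ?_ h
      -- Rounding `n / d` down loses at most a factor 2 because `d ≤ n`.
      have hdiv : n ≤ 2 * (n / d * d) := by
        have h1 : 1 ≤ n / d := (Nat.one_le_div_iff hd).2 hdn
        have h2 := Nat.lt_div_mul_add (a := n) hd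
        have h3 : d ≤ n / d * d := Nat.le_mul_of_pos_left d h1
        omega
      have hdiv' : (n : ℝ) ≤ 2 * (((n / d : ℕ) : ℝ) * d) := by exact_mod_cast hdiv
      calc θ ^ 4 * (d : ℝ) ^ 2 * n / 18432
          ≤ θ ^ 4 * (d : ℝ) ^ 2 * (2 * (((n / d : ℕ) : ℝ) * d)) / 18432 := by gcongr
        _ = _ := by ring
  let L : Iteration n d := ⟨F, G, H, hF.1, hG.1, hH.1, hF.2, hG.2, hH.2⟩
  refine ⟨L, ?_⟩
  have hdisj : (L.uncomputed T).card + (inClusters T F G H).card ≤ T.card := by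
    rw [← Finset.card_union_of_disjoint]
    · exact Finset.card_le_card (Finset.union_subset (L.uncomputed_subset T)
        (Finset.filter_subset _ _))
    · refine Finset.disjoint_left.2 fun t ht ht' => ?_
      exact (L.mem_uncomputed.1 ht).2 (Finset.mem_filter.1 ht').2
  have hdisj' : ((L.uncomputed T).card : ℝ) + (inClusters T F G H).card ≤ T.card := by
    exact_mod_cast hdisj
  linarith

theorem exists_iterations {d : ℕ} (hd : 1 ≤ d) (hdn : d ≤ n) {θ : ℝ} (hθ0 : 0 < θ)
    (hθ1 : θ ≤ 1) (N : ℕ) : ∀ {T : Finset (Term n)}, SparseTriples d T →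
    ∃ Ls : List (Iteration n d), Ls.length ≤ N ∧
      (((uncomputedAfter Ls T).card : ℝ) ≤ θ * d ^ 2 * n ∨
        ((uncomputedAfter Ls T).card : ℝ) + N * (θ ^ 4 * d ^ 2 * n / 18432) ≤ T.card) := by
  induction N with
  | zero =>
    intro T _
    exact ⟨[], le_rfl, Or.inr (by simp [uncomputedAfter])⟩
  | succ N ih =>
    intro T hT
    rcases le_total (T.card : ℝ) (θ * d ^ 2 * n) with h | h
    · exact ⟨[], Nat.zero_le _, Or.inl h⟩
    · obtain ⟨L, hL⟩ := exists_iteration hd hdn hT hθ0 hθ1 h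
      obtain ⟨Ls, hlen, hLs⟩ := ih (hT.mono (L.uncomputed_subset T))
      refine ⟨L :: Ls, Nat.succ_le_succ hlen, hLs.imp id fun h' => ?_⟩
      rw [uncomputedAfter]
      push_cast
      linarith

theorem sparseTriples_of_subset_terms {d : ℕ} {R : Type*} [Semiring R]
    {A B : Matrix (Fin n) (Fin n) R} {S : Finset (Fin n × Fin n)} (hA : IsSparse d A)
    (hB : IsSparse d B) (hS : SparsePattern d fun i k => (i, k) ∈ S) {T : Finset (Term n)}
    (hT : T ⊆ terms A B S) : SparseTriples d T := by
  have key : ∀ (f g : Term n → Fin n) (r : Fin n → Fin n → Prop),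
      (∀ v, {w | r v w}.ncard ≤ d) → (∀ t ∈ T, r (f t) (g t)) → FiberBound d T f g := by
    intro f g r hr hfg v
    refine le_trans ?_ (hr v)
    rw [← Set.ncard_coe_finset]
    refine Set.ncard_le_ncard ?_ (Set.toFinite _)
    intro w hw
    obtain ⟨t, ht, rfl⟩ := Finset.mem_image.1 (Finset.mem_coe.1 hw)
    obtain ⟨htT, rfl⟩ := Finset.mem_filter.1 ht
    exact hfg t htT
  have hmem : ∀ t ∈ T, A t.1 t.2.1 ≠ 0 ∧ B t.2.1 t.2.2 ≠ 0 ∧ (t.1, t.2.2) ∈ S := fun t ht => by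
    simpa [terms] using hT ht
  exact ⟨key _ _ _ hA.1 fun t ht => (hmem t ht).1, key _ _ _ hS.1 fun t ht => (hmem t ht).2.2,
    key _ _ (fun j i => A i j ≠ 0) hA.2 fun t ht => (hmem t ht).1,
    key _ _ _ hB.1 fun t ht => (hmem t ht).2.1,
    key _ _ (fun k i => (i, k) ∈ S) hS.2 fun t ht => (hmem t ht).2.2,
    key _ _ (fun k j => B j k ≠ 0) hB.2 fun t ht => (hmem t ht).2.1⟩

end Triples

end SparseMM

/-! ### Choice of constants -/

theorem mainTheorem6 (ε₁ ε₂ : ℝ) (hε₁ : 0 ≤ ε₁) (hε : ε₁ < ε₂)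
    (C₁ C₂ : ℝ) (hC₁ : 0 < C₁) (hC₂ : 0 < C₂) :
    ∃ K : ℝ, 0 < K ∧
      ∀ (R : Type*) [Semiring R] (n d : ℕ), 1 ≤ d → d ≤ n →
        ∀ (A B : Matrix (Fin n) (Fin n) R) (S : Finset (Fin n × Fin n)),
          SparseMM.IsSparse d A → SparseMM.IsSparse d B →
          SparseMM.SparsePattern d (fun i k => (i, k) ∈ S) →
          ∀ T : Finset (SparseMM.Term n), T ⊆ SparseMM.terms A B S →
            (T.card : ℝ) ≤ C₁ * ((d : ℝ) ^ (2 - ε₁) * (n : ℝ)) →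
            ∃ Ls : List (SparseMM.Iteration n d),
              (Ls.length : ℝ) ≤ K * (d : ℝ) ^ (4 * ε₂) ∧
              ((SparseMM.uncomputedAfter Ls T).card : ℝ) ≤
                C₂ * ((d : ℝ) ^ (2 - ε₂) * (n : ℝ)) := by
  -- Truncating at 1 ensures `θ ≤ 1` below. The final `+ 1` in the constant absorbs the rounding of
  -- the number of iterations, since `d ^ (4 * ε₂) ≥ 1`.
  set c : ℝ := min C₂ 1 with hc
  have hc0 : 0 < c := lt_min hC₂ one_pos
  refine ⟨18432 * C₁ / c ^ 4 + 1, by positivity, ?_⟩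
  intro R _ n d hd hdn A B S hA hB hS T hT hcard
  have hd1 : (1 : ℝ) ≤ d := by exact_mod_cast hd
  have hd0 : (0 : ℝ) < d := by linarith
  have hn0 : (0 : ℝ) < n := by exact_mod_cast hd.trans hdn
  have hε₂ : 0 ≤ ε₂ := hε₁.trans hε.le
  set θ : ℝ := c * (d : ℝ) ^ (-ε₂) with hθ
  have hpow0 : 0 < (d : ℝ) ^ (-ε₂) := Real.rpow_pos_of_pos hd0 _
  have hθ0 : 0 < θ := mul_pos hc0 hpow0
  have hθ1 : θ ≤ 1 := mul_le_one₀ (min_le_right _ _) hpow0.le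
    (Real.rpow_le_one_of_one_le_of_nonpos hd1 (neg_nonpos.2 hε₂))
  have hθ4 : θ ^ 4 * (d : ℝ) ^ (4 * ε₂) = c ^ 4 := by
    rw [hθ, mul_pow, ← Real.rpow_natCast ((d : ℝ) ^ (-ε₂)) 4, ← Real.rpow_mul hd0.le, mul_assoc,
      ← Real.rpow_add hd0]
    norm_num
    rw [show -(ε₂ * 4) + 4 * ε₂ = 0 by ring, Real.rpow_zero, mul_one]
  have hT2 : (T.card : ℝ) ≤ C₁ * (d ^ 2 * n) := by
    refine hcard.trans ?_
    have : (d : ℝ) ^ (2 - ε₁) ≤ (d : ℝ) ^ 2 := by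
      rw [← Real.rpow_two]
      exact Real.rpow_le_rpow_of_exponent_le hd1 (by linarith)
    gcongr
  -- One more than the floor makes `N` strictly exceed the quotient, so `N` full gains would exceed
  -- `C₁ d² n ≥ |T|`.
  set N : ℕ := ⌊18432 * C₁ / θ ^ 4⌋₊ + 1 with hN
  obtain ⟨Ls, hlen, hLs⟩ := SparseMM.exists_iterations hd hdn hθ0 hθ1 N
    (SparseMM.sparseTriples_of_subset_terms hA hB hS hT)
  refine ⟨Ls, ?_, ?_⟩
  · have h1 : (Ls.length : ℝ) ≤ 18432 * C₁ / θ ^ 4 + 1 := by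
      calc (Ls.length : ℝ) ≤ N := by exact_mod_cast hlen
        _ ≤ 18432 * C₁ / θ ^ 4 + 1 := by
          rw [hN]; push_cast
          gcongr
          exact Nat.floor_le (by positivity)
    have h2 : 18432 * C₁ / θ ^ 4 = 18432 * C₁ / c ^ 4 * (d : ℝ) ^ (4 * ε₂) := by
      rw [← hθ4]
      have : (d : ℝ) ^ (4 * ε₂) ≠ 0 := (Real.rpow_pos_of_pos hd0 _).ne'
      field_simp
    have h3 : 1 ≤ (d : ℝ) ^ (4 * ε₂) := Real.one_le_rpow hd1 (by positivity)
    rw [add_mul, one_mul]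
    linarith
  · rcases hLs with h | h
    · refine h.trans ?_
      have : (d : ℝ) ^ (2 - ε₂) = (d : ℝ) ^ (-ε₂) * d ^ 2 := by
        rw [← Real.rpow_two, ← Real.rpow_add hd0]
        congr 1
        ring
      rw [this, hθ]
      calc c * (d : ℝ) ^ (-ε₂) * d ^ 2 * n ≤ C₂ * (d : ℝ) ^ (-ε₂) * d ^ 2 * n := by
            gcongr
            exact min_le_left _ _
        _ = _ := by ring
    · exfalso
      have hlt : 18432 * C₁ / θ ^ 4 < N := by
        rw [hN]; push_cast
        exact Nat.lt_floor_add_one _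
      have hγ : 0 < θ ^ 4 * (d : ℝ) ^ 2 * n / 18432 := by positivity
      have hbig := mul_lt_mul_of_pos_right hlt hγ
      have heq : 18432 * C₁ / θ ^ 4 * (θ ^ 4 * (d : ℝ) ^ 2 * n / 18432) = C₁ * (d ^ 2 * n) := by
        field_simp
      have hnn : (0 : ℝ) ≤ ((SparseMM.uncomputedAfter Ls T).card : ℝ) := Nat.cast_nonneg _
      linarith
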